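/- Let $R$ be a commutative ring, let $m,n\ge 0$ be integers, let $A,B$ be $m\times n$ matrices and $X$ an $n\times n$ matrix with entries in $R$, and let $\mathcal J$ be the $n\times n$ matrix all of whose entries are $1$. Write $[n]=\{1,\dots,n\}$. For $I,J\subseteq[n]$ let $X_{I,J}$ be the submatrix of $X$ with rows indexed by $I$ and columns indexed by $J$, let $A^I$ and $B^J$ be the submatrices of $A$ and $B$ consisting of the columns indexed by $I$ and $J$, respectively (rows and columns always in increasing order), and let $(A^I B^J)$ denote the concatenation of $A^I$ and $B^J$. (a) If $m$ is even, then $$\det\bigl(AXB^t+B(\mathcal J-X^t)A^t\bigr)=f_{A,B}(X)\,f_{B,A}(\mathcal J-X^t),$$ where, for all $m\times n$ matrices $A,B$ and every $n\times n$ matrix $X$, $$f_{A,B}(X)=\sum_{\substack{I,J\subseteq[n]\\ |I|=|J|=m/2}}\det X_{I,J}\,\det(A^I B^J).$$ (b) If $m$ is odd, then $$\det\bigl(AXB^t+B(\mathcal J-X^t)A^t\bigr)=g_{A,B}(X)\,g_{B,A}(\mathcal J-X^t)=(-1)^{(m-1)/2}\,g_{A,B}(X)\,g_{B,A}(X^t),$$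 where, for all $m\times n$ matrices $A,B$ and every $n\times n$ matrix $X$, $$g_{A,B}(X)=\sum_{\substack{I,J\subseteq[n]\\ |I|=(m+1)/2,\ |J|=(m-1)/2}}\det\bigl(\mathbf 1\;X_{I,J}\bigr)\,\det(A^I B^J),$$ with $\mathbf 1$ the column of length $(m+1)/2$ consisting entirely of $1$'s, and $(\mathbf 1\;X_{I,J})$ the square matrix obtained by putting this column in front of $X_{I,J}$. -/

import Mathlib

namespace MinorSum

variable {R : Type*} [CommRing R]

/-- The `n × n` matrix all of whose entries are `1`. -/
def allOnes (R : Type*) [CommRing R] (n : ℕ) : Matrix (Fin n) (Fin n) R :=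
  Matrix.of fun _ _ => 1

/-- The column of length `k` all of whose entries are `1`. -/
def onesCol (R : Type*) [CommRing R] (k : ℕ) : Matrix (Fin k) (Fin 1) R :=
  Matrix.of fun _ _ => 1

/-- The `k`-element subsets of the index set `[n]`. -/
abbrev KSubset (n k : ℕ) : Type := {I : Finset (Fin n) // I.card = k}

/-- `colSub A I` is `A^I`: the columns of `A` indexed by `I`, in increasing order. -/
def colSub {m n k : ℕ} (A : Matrix (Fin m) (Fin n) R) (I : KSubset n k) :
    Matrix (Fin m) (Fin k) R :=
  A.submatrix id (I.1.orderEmbOfFin I.2)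

/-- `minorSub X I J` is `X_{I,J}`: the rows of `X` indexed by `I` and the columns indexed by `J`,
both in increasing order. -/
def minorSub {n k l : ℕ} (X : Matrix (Fin n) (Fin n) R) (I : KSubset n k) (J : KSubset n l) :
    Matrix (Fin k) (Fin l) R :=
  X.submatrix (I.1.orderEmbOfFin I.2) (J.1.orderEmbOfFin J.2)

/-- The concatenation `(P Q)` of a matrix `P` with `p` columns and a matrix `Q` with `q` columns,
where `p + q = N`: first the columns of `P`, then those of `Q`. -/
def concat {r p q N : ℕ} (h : p + q = N) (P : Matrix (Fin r) (Fin p) R)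
    (Q : Matrix (Fin r) (Fin q) R) : Matrix (Fin r) (Fin N) R :=
  (Matrix.fromCols P Q).submatrix id fun j => finSumFinEquiv.symm (Fin.cast h.symm j)

theorem half_add_half {m : ℕ} (hm : Even m) : m / 2 + m / 2 = m := by
  obtain ⟨k, rfl⟩ := hm
  omega

theorem upper_add_lower {m : ℕ} (hm : Odd m) : (m + 1) / 2 + (m - 1) / 2 = m := by
  obtain ⟨k, rfl⟩ := hm
  omega

theorem one_add_lower {m : ℕ} (hm : Odd m) : 1 + (m - 1) / 2 = (m + 1) / 2 := by
  obtain ⟨k, rfl⟩ := hm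
  omega

/-- For even `m`, the sum of `det X_{I,J} * det (A^I B^J)` over all `I, J ⊆ [n]` with
`|I| = |J| = m / 2`. -/
def f {m n : ℕ} (hm : Even m) (A B : Matrix (Fin m) (Fin n) R) (X : Matrix (Fin n) (Fin n) R) :
    R :=
  ∑ I : KSubset n (m / 2), ∑ J : KSubset n (m / 2),
    (minorSub X I J).det * (concat (half_add_half hm) (colSub A I) (colSub B J)).det

/-- For odd `m`, the sum of `det (1 X_{I,J}) * det (A^I B^J)` over all `I, J ⊆ [n]` with
`|I| = (m + 1) / 2` and `|J| = (m - 1) / 2`. -/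
def g {m n : ℕ} (hm : Odd m) (A B : Matrix (Fin m) (Fin n) R) (X : Matrix (Fin n) (Fin n) R) :
    R :=
  ∑ I : KSubset n ((m + 1) / 2), ∑ J : KSubset n ((m - 1) / 2),
    (concat (one_add_lower hm) (onesCol R ((m + 1) / 2)) (minorSub X I J)).det *
      (concat (upper_add_lower hm) (colSub A I) (colSub B J)).det

end MinorSum

open scoped Matrix

open scoped Matrix
-- Put `P = A X Bᵗ`, `a = A 1`, `b = B 1`. As `𝒥 = 1 1ᵗ`, the second summand is `b aᵗ - Pᵗ`, so the
-- matrix in question is `M + b aᵗ` with `M = P - Pᵗ` alternating.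
--
-- For `m = 2k`, `k! f_{A,B}(X)` is `matchingSum P` (`factorial_mul_minorSum`), so `f_{A,B}(X)` is,
-- up to a sign depending only on `k`, the Pfaffian of `M`. The other factor is likewise the
-- Pfaffian of `M + b aᵗ - a bᵗ`. The even case thus says `Pf(M) Pf(M + b aᵗ - a bᵗ) = det(M + b
-- aᵗ)`. If `M` is invertible, take `cᵗ M = aᵗ` and `H = 1 + b cᵗ`: then `H M = M + b aᵗ` and `H M
-- Hᵗ = M + b aᵗ - a bᵗ`, so `Pf(H M Hᵗ) = det H Pf(M)` (`matchingSum_conj`) and `Pf² = det` give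
-- the claim. The same update, applied one matrix entry at a time, proves `Pf² = det`
-- (`matchingSum_interpolation_sq`). Invertibility comes from a polynomial interpolation, and
-- arbitrary rings are reached from generic matrices over `ℤ`.
--
-- The odd case follows from the even one for `A`, `B`, `X` enlarged by a row and a column
-- (`minorSum_bordered`).
namespace MinorSum
open Equiv Finset

/-! ### Signed matching sums: an unnormalised Pfaffian. -/

section MatchingSum

variable {R : Type*} [CommRing R] {p : Type*} [Fintype p] [DecidableEq p]

/-- The signed sum over all permutations `σ` of `p ⊕ p` of `∏ i, P (σ i) (σ i')`, where `i` and `i'`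
are the two copies of `i : p`. It equals, up to sign, `p!` times the Pfaffian of `P - Pᵀ`. -/
def matchingSum (P : Matrix (p ⊕ p) (p ⊕ p) R) : R :=
  ∑ σ : Perm (p ⊕ p), (Perm.sign σ : ℤ) • ∏ i, P (σ (Sum.inl i)) (σ (Sum.inr i))

theorem map_matchingSum {S : Type*} [CommRing S] (φ : R →+* S) (P : Matrix (p ⊕ p) (p ⊕ p) R) :
    φ (matchingSum P) = matchingSum (P.map φ) := by
  simp [matchingSum, map_sum, map_prod]

/-- The version of `matchingSum` with a different matrix for each element of `p`. -/
def matchingSumFamily (Q : p → Matrix (p ⊕ p) (p ⊕ p) R) : R :=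
  ∑ σ : Perm (p ⊕ p), (Perm.sign σ : ℤ) • ∏ i, Q i (σ (Sum.inl i)) (σ (Sum.inr i))

/-- Composing `σ` with the transposition of the two copies of `j` flips the sign and changes no
factor, so the sum is its own negative. -/
theorem matchingSumFamily_eq_zero_of_isSymm [NoZeroDivisors R] [CharZero R]
    (Q : p → Matrix (p ⊕ p) (p ⊕ p) R) (j : p) (hj : (Q j).IsSymm) :
    matchingSumFamily Q = 0 := by
  have h : matchingSumFamily Q = -matchingSumFamily Q := by
    conv_lhs => rw [matchingSumFamily]
    rw [← Equiv.sum_comp (Equiv.mulRight (swap (Sum.inl j) (Sum.inr j))), matchingSumFamily,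
      ← Finset.sum_neg_distrib]
    refine Finset.sum_congr rfl fun σ _ => ?_
    have : ∀ i, Q i ((σ * swap (Sum.inl j) (Sum.inr j)) (Sum.inl i))
        ((σ * swap (Sum.inl j) (Sum.inr j)) (Sum.inr i)) =
        Q i (σ (Sum.inl i)) (σ (Sum.inr i)) := by
      intro i
      by_cases hi : i = j
      · subst hi
        simpa using hj.apply _ _
      · rw [Perm.mul_apply, Perm.mul_apply, swap_apply_of_ne_of_ne (by simpa using hi) (by simp),
          swap_apply_of_ne_of_ne (by simp) (by simpa using hi)]
    rw [Equiv.coe_mulRight, Finset.prod_congr rfl fun i _ => this i]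
    simp
  exact self_eq_neg.mp h

/-- `matchingSum P` depends only on `P - Pᵀ`. -/
theorem matchingSum_congr [NoZeroDivisors R] [CharZero R] {P P' : Matrix (p ⊕ p) (p ⊕ p) R}
    (h : P - Pᵀ = P' - P'ᵀ) : matchingSum P = matchingSum P' := by
  -- `P` is replaced by `P'` at one index at a time. By multilinearity each replacement adds a
  -- family whose member at `j` is the symmetric matrix `P' - P`, and such a family sums to zero.
  have key : ∀ s : Finset p,
      matchingSumFamily (fun i => if i ∈ s then P' else P) = matchingSum P := by
    intro s
    induction s using Finset.induction_on with
    | empty => simp [matchingSumFamily, matchingSum]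
    | insert j s hj ih =>
      rw [← ih, ← sub_eq_zero]
      have hY : (P' - P).IsSymm := by
        ext a b
        have := congr_fun (congr_fun h a) b
        simp only [Matrix.sub_apply, Matrix.transpose_apply] at this ⊢
        linear_combination this
      rw [← matchingSumFamily_eq_zero_of_isSymm
        (Function.update (fun i => if i ∈ s then P' else P) j (P' - P)) j (by simpa using hY)]
      simp only [matchingSumFamily, ← Finset.sum_sub_distrib, ← smul_sub]
      refine Finset.sum_congr rfl fun σ _ => ?_
      congr 1
      rw [← Finset.mul_prod_erase univ _ (mem_univ j), ← Finset.mul_prod_erase univ _ (mem_univ j),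
        ← Finset.mul_prod_erase univ
          (fun i => Function.update (fun i => if i ∈ s then P' else P) j (P' - P) i _ _)
          (mem_univ j)]
      simp only [mem_insert_self, if_true, hj, if_false, Function.update_self, Matrix.sub_apply]
      rw [sub_mul]
      congr 2 <;> refine Finset.prod_congr rfl fun i hi => ?_ <;>
        simp [Finset.ne_of_mem_erase hi]
  rw [← key univ]
  simp [matchingSumFamily, matchingSum]

/-- After multiplying out the entries of `A * X * Bᵀ`, the signed sum over `σ` for fixed `u`, `v` is
a Leibniz expansion. -/
theorem matchingSum_mul_mul_transpose {n n' : Type*} [Fintype n] [Fintype n'] [DecidableEq n]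
    [DecidableEq n'] (A : Matrix (p ⊕ p) n R) (X : Matrix n n' R) (B : Matrix (p ⊕ p) n' R) :
    matchingSum (A * X * Bᵀ) = ∑ u : p → n, ∑ v : p → n', (∏ i, X (u i) (v i)) *
      (Matrix.fromCols (A.submatrix id u) (B.submatrix id v)).det := by
  have h1 : ∀ a b, (A * X * Bᵀ) a b = ∑ w : n × n', A a w.1 * X w.1 w.2 * B b w.2 := by
    intro a b
    simp only [Matrix.mul_apply, Matrix.transpose_apply, Finset.sum_mul]
    rw [Finset.sum_comm, Fintype.sum_prod_type]
  symm
  rw [← Fintype.sum_prod_type',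
    ← Equiv.sum_comp (Equiv.arrowProdEquivProdArrow p (fun _ => n) (fun _ => n'))]
  simp only [matchingSum, h1, Finset.prod_univ_sum, Fintype.piFinset_univ, Finset.smul_sum]
  rw [Finset.sum_comm (s := (univ : Finset (Perm (p ⊕ p))))]
  refine Finset.sum_congr rfl fun w _ => ?_
  rw [Matrix.det_apply, Finset.mul_sum]
  refine Finset.sum_congr rfl fun σ _ => ?_
  simp only [Fintype.prod_sum_type, Finset.prod_mul_distrib, Units.smul_def, zsmul_eq_mul]
  simp [Equiv.arrowProdEquivProdArrow]
  ring

/-- In the expansion over pairs `(u, v)`, read as self-maps of `p ⊕ p`, a non-injective map repeats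
a column of `G` and a permutation `σ` contributes `sign σ * det G`. -/
theorem matchingSum_conj (G P : Matrix (p ⊕ p) (p ⊕ p) R) :
    matchingSum (G * P * Gᵀ) = G.det * matchingSum P := by
  rw [matchingSum_mul_mul_transpose, ← Fintype.sum_prod_type',
    ← Equiv.sum_comp (Equiv.sumArrowEquivProdArrow p p (p ⊕ p))]
  have h0 : ∀ w : p ⊕ p → p ⊕ p,
      Matrix.fromCols (G.submatrix id (Equiv.sumArrowEquivProdArrow p p (p ⊕ p) w).1)
        (G.submatrix id (Equiv.sumArrowEquivProdArrow p p (p ⊕ p) w).2) = G.submatrix id w := by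
    intro w
    ext a (b | b) <;> simp [Equiv.sumArrowEquivProdArrow]
  simp only [h0]
  rw [matchingSum, Finset.mul_sum]
  symm
  refine Finset.sum_of_injOn (fun σ : Perm (p ⊕ p) => (σ : p ⊕ p → p ⊕ p))
    (fun _ _ _ _ h => DFunLike.coe_injective h) (by simp) ?_ ?_
  · intro w _ hw
    have hninj : ¬ Function.Injective w := fun hi =>
      hw ⟨Equiv.ofBijective w (Finite.injective_iff_bijective.mp hi), by simp, rfl⟩
    obtain ⟨a, b, hab, hne⟩ := Function.not_injective_iff.mp hninj
    rw [Matrix.det_zero_of_column_eq hne (fun k => by simp [hab]), mul_zero]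
  · intro σ _
    rw [Matrix.det_permute']
    simp [Equiv.sumArrowEquivProdArrow]
    ring

/-- The matrix with entries `1` exactly at the positions `(i, i')`. -/
def halfMatching (R p : Type*) [CommRing R] [Fintype p] [DecidableEq p] :
    Matrix (p ⊕ p) (p ⊕ p) R :=
  Matrix.fromBlocks 0 1 0 0

theorem map_halfMatching {S : Type*} [CommRing S] (φ : R →+* S) :
    (halfMatching R p).map φ = halfMatching S p := by
  simp [halfMatching, Matrix.fromBlocks_map]

/-- The factor `1` in the middle forces `v = u`. The remaining determinant is the square of that of
a matrix of `u`: `1` for each permutation `u`, `0` otherwise. -/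
theorem matchingSum_halfMatching :
    matchingSum (halfMatching R p) = ((Fintype.card p).factorial : R) := by
  have h : halfMatching R p = Matrix.fromRows (1 : Matrix p p R) (0 : Matrix p p R) *
      (1 : Matrix p p R) * (Matrix.fromRows (0 : Matrix p p R) (1 : Matrix p p R))ᵀ := by
    rw [Matrix.transpose_fromRows, Matrix.mul_one, Matrix.fromRows_mul_fromCols]
    simp [halfMatching]
  rw [h, matchingSum_mul_mul_transpose]
  have h2 : ∀ u v : p → p, (∏ i, (1 : Matrix p p R) (u i) (v i)) = if v = u then 1 else 0 := by
    intro u v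
    simp only [Matrix.one_apply, Finset.prod_ite_zero, Finset.prod_const_one]
    simp [funext_iff, eq_comm]
  simp only [h2, ite_mul, one_mul, zero_mul, Finset.sum_ite_eq', mem_univ, if_true]
  have h3 : ∀ u : p → p, Matrix.fromCols
      ((Matrix.fromRows (1 : Matrix p p R) (0 : Matrix p p R)).submatrix id u)
      ((Matrix.fromRows (0 : Matrix p p R) (1 : Matrix p p R)).submatrix id u) =
      Matrix.fromBlocks ((1 : Matrix p p R).submatrix id u) 0 0
        ((1 : Matrix p p R).submatrix id u) := by
    intro u
    ext (a | a) (b | b) <;> rfl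
  simp only [h3, Matrix.det_fromBlocks_zero₂₁]
  rw [← Fintype.card_perm, ← Finset.card_univ, Finset.cast_card]
  symm
  refine Finset.sum_of_injOn (fun σ : Perm p => (σ : p → p))
    (fun _ _ _ _ h => DFunLike.coe_injective h) (by simp) ?_ ?_
  · intro w _ hw
    have hninj : ¬ Function.Injective w := fun hi =>
      hw ⟨Equiv.ofBijective w (Finite.injective_iff_bijective.mp hi), by simp, rfl⟩
    obtain ⟨a, b, hab, hne⟩ := Function.not_injective_iff.mp hninj
    rw [Matrix.det_zero_of_column_eq hne (fun k => by
      rw [Matrix.submatrix_apply, Matrix.submatrix_apply, hab]), mul_zero]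
  · intro σ _
    rw [Matrix.det_permute']
    rcases Int.units_eq_one_or (Perm.sign σ) with h | h <;> simp [h]

/-- The standard alternating form is a product of three unipotent block matrices. It is the
invertible base point of the interpolation. -/
theorem det_halfMatching_sub_transpose :
    (halfMatching R p - (halfMatching R p)ᵀ).det = 1 := by
  have h : halfMatching R p - (halfMatching R p)ᵀ =
      Matrix.fromBlocks 1 1 0 1 * Matrix.fromBlocks 1 0 (-1) 1 * Matrix.fromBlocks 1 1 0 1 := by
    simp [halfMatching, Matrix.fromBlocks_multiply, Matrix.fromBlocks_transpose, sub_eq_add_neg,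
      Matrix.fromBlocks_neg, Matrix.fromBlocks_add]
  rw [h, Matrix.det_mul, Matrix.det_mul]
  simp

end MatchingSum


/-! ### Rank one updates, the square of the Pfaffian, and the product formula. -/

section RankOneUpdate

variable {R : Type*} [CommRing R] {p : Type*} [Fintype p] [DecidableEq p]

theorem dotProduct_vecMul_sub_transpose_self {ι : Type*} [Fintype ι] (P : Matrix ι ι R)
    (c : ι → R) : (c ᵥ* (P - Pᵀ)) ⬝ᵥ c = 0 := by
  rw [Matrix.vecMul_sub, sub_dotProduct, Matrix.vecMul_transpose, ← Matrix.dotProduct_mulVec,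
    dotProduct_comm (P *ᵥ c), sub_self]

theorem matchingSum_add_vecMulVec_of_isUnit [NoZeroDivisors R] [CharZero R]
    (P : Matrix (p ⊕ p) (p ⊕ p) R) (a b : p ⊕ p → R) (hP : IsUnit (P - Pᵀ).det) :
    matchingSum (P + Matrix.vecMulVec b a) * (P - Pᵀ).det =
        matchingSum P * (P - Pᵀ + Matrix.vecMulVec b a).det ∧
      ((P + Matrix.vecMulVec b a) - (P + Matrix.vecMulVec b a)ᵀ).det * (P - Pᵀ).det =
        (P - Pᵀ + Matrix.vecMulVec b a).det ^ 2 := by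
  obtain ⟨c, hc⟩ : ∃ c, c ᵥ* (P - Pᵀ) = a :=
    ⟨a ᵥ* (P - Pᵀ)⁻¹, by rw [Matrix.vecMul_vecMul, Matrix.nonsing_inv_mul _ hP, Matrix.vecMul_one]⟩
  have hc' : (P - Pᵀ) *ᵥ c = -a := by
    rw [← hc, ← Matrix.vecMul_transpose, Matrix.transpose_sub, Matrix.transpose_transpose,
      ← Matrix.vecMul_neg, neg_sub]
  have hac : a ⬝ᵥ c = 0 := by rw [← hc, dotProduct_vecMul_sub_transpose_self]
  set H := 1 + Matrix.vecMulVec b c with hH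
  have h1 : H * (P - Pᵀ) = P - Pᵀ + Matrix.vecMulVec b a := by
    rw [hH, add_mul, one_mul, Matrix.vecMulVec_mul, hc]
  have h2 : H * (P - Pᵀ) * Hᵀ =
      (P + Matrix.vecMulVec b a) - (P + Matrix.vecMulVec b a)ᵀ := by
    -- The unwanted `b bᵗ` term has coefficient `a ⬝ᵥ c = 0`, because `P - Pᵀ` is alternating.
    rw [h1, hH, Matrix.transpose_add, Matrix.transpose_one, Matrix.transpose_vecMulVec, mul_add,
      mul_one, add_mul, Matrix.mul_vecMulVec, hc', Matrix.vecMulVec_mul_vecMulVec, hac,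
      Matrix.transpose_add, Matrix.transpose_vecMulVec, Matrix.neg_vecMulVec]
    simp
    abel
  have h3 : matchingSum (P + Matrix.vecMulVec b a) = H.det * matchingSum P := by
    rw [← matchingSum_conj]
    refine matchingSum_congr ?_
    rw [← h2]
    simp only [Matrix.transpose_mul, Matrix.transpose_transpose, mul_sub, sub_mul, mul_assoc]
  constructor
  · rw [h3, ← h1, Matrix.det_mul]; ring
  · rw [← h2, ← h1]
    simp only [Matrix.det_mul, Matrix.det_transpose]
    ring

theorem map_vecMulVec {S ι : Type*} [CommRing S] (φ : R →+* S) (b a : ι → R) :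
    (Matrix.vecMulVec b a).map φ = Matrix.vecMulVec (φ ∘ b) (φ ∘ a) := by
  ext; simp [Matrix.vecMulVec_apply]

/-- Over the fraction field a nonzero determinant is a unit, and both identities are free of
denominators. -/
theorem matchingSum_add_vecMulVec [IsDomain R] [CharZero R]
    (P : Matrix (p ⊕ p) (p ⊕ p) R) (a b : p ⊕ p → R) (hP : (P - Pᵀ).det ≠ 0) :
    matchingSum (P + Matrix.vecMulVec b a) * (P - Pᵀ).det =
        matchingSum P * (P - Pᵀ + Matrix.vecMulVec b a).det ∧
      ((P + Matrix.vecMulVec b a) - (P + Matrix.vecMulVec b a)ᵀ).det * (P - Pᵀ).det =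
        (P - Pᵀ + Matrix.vecMulVec b a).det ^ 2 := by
  let φ := algebraMap R (FractionRing R)
  have hφ : Function.Injective φ := IsFractionRing.injective R (FractionRing R)
  have : CharZero (FractionRing R) := charZero_of_injective_algebraMap hφ
  have hmap : ∀ Q : Matrix (p ⊕ p) (p ⊕ p) R, φ Q.det = (Q.map φ).det := fun Q =>
    RingHom.map_det φ Q
  have hu : IsUnit (P.map φ - (P.map φ)ᵀ).det := by
    rw [isUnit_iff_ne_zero, ← Matrix.transpose_map, ← Matrix.map_sub φ (map_sub φ), ← hmap]
    exact (map_ne_zero_iff φ hφ).mpr hP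
  have := matchingSum_add_vecMulVec_of_isUnit (P.map φ) (φ ∘ a) (φ ∘ b) hu
  constructor
  · apply hφ
    simpa only [map_mul, map_matchingSum, hmap, Matrix.map_add φ (map_add φ),
      Matrix.map_sub φ (map_sub φ), Matrix.transpose_map, map_vecMulVec] using this.1
  · apply hφ
    simpa only [map_mul, map_pow, map_matchingSum, hmap, Matrix.map_add φ (map_add φ),
      Matrix.map_sub φ (map_sub φ), Matrix.transpose_map, map_vecMulVec] using this.2

open Polynomial in
/-- The matrix over `R[X]` interpolating between `halfMatching R p` at `0` and `P` at `1`. -/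
noncomputable def interpolation (P : Matrix (p ⊕ p) (p ⊕ p) R) : Matrix (p ⊕ p) (p ⊕ p) R[X] :=
  halfMatching R[X] p + (X : R[X]) • (P - halfMatching R p).map C

open Polynomial in
theorem map_evalRingHom_zero_interpolation (P : Matrix (p ⊕ p) (p ⊕ p) R) :
    (interpolation P).map (evalRingHom 0) = halfMatching R p := by
  rw [interpolation, Matrix.map_add _ (map_add _), map_halfMatching]
  ext; simp

open Polynomial in
theorem map_evalRingHom_one_interpolation (P : Matrix (p ⊕ p) (p ⊕ p) R) :
    (interpolation P).map (evalRingHom 1) = P := by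
  rw [interpolation, Matrix.map_add _ (map_add _), map_halfMatching]
  ext; simp

open Polynomial in
theorem det_interpolation_sub_transpose_ne_zero [Nontrivial R] (P : Matrix (p ⊕ p) (p ⊕ p) R) :
    (interpolation P - (interpolation P)ᵀ).det ≠ 0 := by
  intro h
  have := congr_arg (evalRingHom (0 : R)) h
  rw [RingHom.map_det, RingHom.mapMatrix_apply, Matrix.map_sub _ (map_sub _), Matrix.transpose_map,
    map_evalRingHom_zero_interpolation, det_halfMatching_sub_transpose] at this
  simp at this

open Polynomial in
theorem matchingSum_interpolation_sq [IsDomain R] [CharZero R] (P : Matrix (p ⊕ p) (p ⊕ p) R) :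
    matchingSum (interpolation P) ^ 2 =
      ((Fintype.card p).factorial : R[X]) ^ 2 * (interpolation P - (interpolation P)ᵀ).det := by
  obtain ⟨Y, rfl⟩ : ∃ Y, P = halfMatching R p + Y := ⟨P - halfMatching R p, by abel⟩
  -- A matrix with a single nonzero entry has rank one, so `Y` can be built up by successive rank
  -- one updates starting from `halfMatching`.
  rw [Matrix.matrix_eq_sum_single Y, ← Finset.sum_product']
  generalize (univ : Finset (p ⊕ p)) ×ˢ (univ : Finset (p ⊕ p)) = s
  induction s using Finset.induction_on with
  | empty => simp [interpolation, matchingSum_halfMatching, det_halfMatching_sub_transpose]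
  | insert w s hw ih =>
    rw [Finset.sum_insert hw]
    generalize ∑ x ∈ s, Matrix.single x.1 x.2 (Y x.1 x.2) = Z at ih ⊢
    have h : interpolation (halfMatching R p + (Matrix.single w.1 w.2 (Y w.1 w.2) + Z)) =
        interpolation (halfMatching R p + Z) +
          Matrix.vecMulVec (Pi.single w.1 X) (Pi.single w.2 (C (Y w.1 w.2))) := by
      have hv : Matrix.vecMulVec (Pi.single w.1 X) (Pi.single w.2 (C (Y w.1 w.2))) =
          Matrix.single w.1 w.2 (X * C (Y w.1 w.2)) := by
        ext1 a b
        simp only [Matrix.vecMulVec_apply, Matrix.single_apply, Pi.single_apply]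
        split_ifs <;> simp_all
      rw [hv]
      ext1 a b
      by_cases hab : w.1 = a ∧ w.2 = b
      · simp [interpolation, hab]
        ring
      · simp [interpolation, Matrix.single_apply_of_ne _ _ _ _ _ hab]
    have hd := det_interpolation_sub_transpose_ne_zero (halfMatching R p + Z)
    obtain ⟨h1, h2⟩ := matchingSum_add_vecMulVec (interpolation (halfMatching R p + Z))
      (Pi.single w.2 (C (Y w.1 w.2))) (Pi.single w.1 X) hd
    rw [h]
    -- Squaring the update of `matchingSum` produces the square of the intermediate determinant,
    -- which the second update formula trades for the new determinant times the old one.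
    apply mul_right_cancel₀ (pow_ne_zero 2 hd)
    rw [← mul_pow, h1, mul_pow, ih, ← h2]
    ring

open Polynomial in
theorem matchingSum_mul_matchingSum [IsDomain R] [CharZero R] (P : Matrix (p ⊕ p) (p ⊕ p) R)
    (a b : p ⊕ p → R) :
    matchingSum P * matchingSum (Matrix.vecMulVec b a - Pᵀ) =
      ((Fintype.card p).factorial : R) ^ 2 * (P - Pᵀ + Matrix.vecMulVec b a).det := by
  have hsymm : matchingSum (Matrix.vecMulVec b a - Pᵀ) =
      matchingSum (P + Matrix.vecMulVec b a) := by
    apply matchingSum_congr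
    simp only [Matrix.transpose_sub, Matrix.transpose_add, Matrix.transpose_transpose]
    abel
  have hd := det_interpolation_sub_transpose_ne_zero P
  have h1 := (matchingSum_add_vecMulVec (interpolation P) (C ∘ a) (C ∘ b) hd).1
  have key : matchingSum (interpolation P) *
      matchingSum (interpolation P + Matrix.vecMulVec (C ∘ b) (C ∘ a)) =
      ((Fintype.card p).factorial : R[X]) ^ 2 *
        (interpolation P - (interpolation P)ᵀ + Matrix.vecMulVec (C ∘ b) (C ∘ a)).det := by
    -- `(P - Pᵀ).det` itself may vanish; its interpolation over `R[X]` does not, so it is cancelled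
    -- there before evaluating at `1`.
    apply mul_right_cancel₀ hd
    rw [mul_assoc, h1, ← mul_assoc, ← sq, matchingSum_interpolation_sq]
    ring
  have hev : ∀ v : p ⊕ p → R, evalRingHom (1 : R) ∘ (C ∘ v) = v := fun v => by ext; simp
  rw [hsymm]
  simpa only [map_mul, map_pow, map_natCast, map_matchingSum, RingHom.map_det,
    RingHom.mapMatrix_apply, Matrix.map_add _ (map_add (evalRingHom (1 : R))),
    Matrix.map_sub _ (map_sub (evalRingHom (1 : R))), Matrix.transpose_map, map_vecMulVec,
    map_evalRingHom_one_interpolation, hev] using congr_arg (evalRingHom (1 : R)) key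

end RankOneUpdate


/-! ### The even case: sums of minors as matching sums. -/

section MinorSummation

variable {R : Type*} [CommRing R]

/-- Functions `Fin k → Fin n` on which a symmetric function with support in the injective functions
is summed are grouped by their image. -/
theorem sum_fun_eq_factorial_mul_sum_kSubset {n k : ℕ} (F : (Fin k → Fin n) → R)
    (h0 : ∀ u, ¬ Function.Injective u → F u = 0) (hF : ∀ u (τ : Perm (Fin k)), F (u ∘ τ) = F u) :
    ∑ u, F u = (k.factorial : R) * ∑ I : KSubset n k, F (I.1.orderEmbOfFin I.2) := by
  have h : ∑ x : KSubset n k × Perm (Fin k), F (x.1.1.orderEmbOfFin x.1.2 ∘ x.2) = ∑ u, F u := by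
    refine Finset.sum_of_injOn (fun x => x.1.1.orderEmbOfFin x.1.2 ∘ x.2) ?_ (by simp) ?_
      (fun _ _ => rfl)
    · rintro ⟨I, τ⟩ - ⟨J, ρ⟩ - hIJ
      have hr : ∀ (I : KSubset n k) (τ : Perm (Fin k)),
          Set.range (I.1.orderEmbOfFin I.2 ∘ τ) = I.1 := fun I τ => by
        rw [EquivLike.range_comp, Finset.range_orderEmbOfFin]
      obtain rfl : I = J := Subtype.ext (Finset.coe_injective (by
        rw [← hr I τ, ← hr J ρ]; exact congr_arg Set.range hIJ))
      refine Prod.ext rfl (Equiv.ext fun i => ?_)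
      exact (I.1.orderEmbOfFin I.2).injective (congr_fun hIJ i)
    · intro u _ hu
      refine h0 u fun hi => hu ?_
      have hc : (univ.image u).card = k := by simp [Finset.card_image_of_injective _ hi]
      -- `w i` is the rank of `u i` in the sorted image of `u`, so `u` is the increasing enumeration
      -- composed with `w`.
      let w : Fin k → Fin k := fun i =>
        ((univ.image u).orderIsoOfFin hc).symm ⟨u i, mem_image_of_mem u (mem_univ i)⟩
      have hw : Function.Injective w := fun i j hij =>
        hi (Subtype.ext_iff.mp (((univ.image u).orderIsoOfFin hc).symm.injective hij))
      refine ⟨(⟨univ.image u, hc⟩, Equiv.ofBijective w (Finite.injective_iff_bijective.mp hw)),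
        by simp, ?_⟩
      ext i
      simp [w, ← Finset.coe_orderIsoOfFin_apply]
  rw [← h, Fintype.sum_prod_type, Finset.mul_sum]
  refine Finset.sum_congr rfl fun I _ => ?_
  refine (Finset.sum_congr rfl fun τ _ => hF (I.1.orderEmbOfFin I.2) τ).trans ?_
  rw [Finset.sum_const, Finset.card_univ,
    Fintype.card_perm, Fintype.card_fin, nsmul_eq_mul]

theorem det_fromCols_submatrix_comp_left {p n n' : Type*} [Fintype p] [DecidableEq p]
    (A : Matrix (p ⊕ p) n R) (B : Matrix (p ⊕ p) n' R) (u : p → n) (v : p → n') (τ : Perm p) :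
    (Matrix.fromCols (A.submatrix id (u ∘ τ)) (B.submatrix id v)).det =
      Perm.sign τ * (Matrix.fromCols (A.submatrix id u) (B.submatrix id v)).det := by
  have h : Matrix.fromCols (A.submatrix id (u ∘ τ)) (B.submatrix id v) =
      (Matrix.fromCols (A.submatrix id u) (B.submatrix id v)).submatrix id
        (Perm.sumCongr τ 1) := by
    ext a (b | b) <;> simp
  rw [h, Matrix.det_permute', Perm.sign_sumCongr]
  simp

theorem det_fromCols_submatrix_comp_right {p n n' : Type*} [Fintype p] [DecidableEq p]
    (A : Matrix (p ⊕ p) n R) (B : Matrix (p ⊕ p) n' R) (u : p → n) (v : p → n') (τ : Perm p) :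
    (Matrix.fromCols (A.submatrix id u) (B.submatrix id (v ∘ τ))).det =
      Perm.sign τ * (Matrix.fromCols (A.submatrix id u) (B.submatrix id v)).det := by
  have h : Matrix.fromCols (A.submatrix id u) (B.submatrix id (v ∘ τ)) =
      (Matrix.fromCols (A.submatrix id u) (B.submatrix id v)).submatrix id
        (Perm.sumCongr 1 τ) := by
    ext a (b | b) <;> simp
  rw [h, Matrix.det_permute', Perm.sign_sumCongr]
  simp

theorem sign_mul_sign_mul {ι : Type*} [Fintype ι] [DecidableEq ι] (τ : Perm ι) (x : R) :
    (Perm.sign τ : R) * ((Perm.sign τ : R) * x) = x := by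
  rcases Int.units_eq_one_or (Perm.sign τ) with h | h <;> simp [h]

/-- Each permutation `τ` in the expansion of the minor of `X` contributes one copy of the matching
sum: reindexing `u` by `τ` moves it into the second determinant, where its sign cancels. -/
theorem sum_det_mul_det_fromCols {p n n' : Type*} [Fintype p] [DecidableEq p] [Fintype n]
    [DecidableEq n] [Fintype n'] [DecidableEq n']
    (A : Matrix (p ⊕ p) n R) (X : Matrix n n' R) (B : Matrix (p ⊕ p) n' R) :
    ∑ u : p → n, ∑ v : p → n', (X.submatrix u v).det *
      (Matrix.fromCols (A.submatrix id u) (B.submatrix id v)).det =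
    ((Fintype.card p).factorial : R) * matchingSum (A * X * Bᵀ) := by
  simp only [Matrix.det_apply' (Matrix.submatrix X _ _), Finset.sum_mul]
  rw [← Fintype.sum_prod_type', Finset.sum_comm]
  rw [← Fintype.card_perm, ← Finset.card_univ, ← nsmul_eq_mul, ← Finset.sum_const]
  refine Finset.sum_congr rfl fun τ _ => ?_
  rw [matchingSum_mul_mul_transpose, Fintype.sum_prod_type]
  rw [← (Equiv.arrowCongr τ (Equiv.refl n)).sum_comp]
  refine Finset.sum_congr rfl fun u _ => Finset.sum_congr rfl fun v _ => ?_
  have hu : Equiv.arrowCongr τ (Equiv.refl n) u = u ∘ ⇑τ⁻¹ := rfl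
  rw [hu, det_fromCols_submatrix_comp_left, Perm.sign_inv, mul_assoc, mul_left_comm (∏ _, _),
    sign_mul_sign_mul]
  simp

/-- The sum of `det X_{I,J} * det (A^I B^J)` over all `k`-element subsets `I, J` of `[n]`. -/
def minorSum {m n k : ℕ} (h : k + k = m) (A B : Matrix (Fin m) (Fin n) R)
    (X : Matrix (Fin n) (Fin n) R) : R :=
  ∑ I : KSubset n k, ∑ J : KSubset n k,
    (minorSub X I J).det * (concat h (colSub A I) (colSub B J)).det

theorem concat_map {S : Type*} [CommRing S] (φ : R →+* S) {r p q N : ℕ} (h : p + q = N)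
    (P : Matrix (Fin r) (Fin p) R) (Q : Matrix (Fin r) (Fin q) R) :
    (concat h P Q).map φ = concat h (P.map φ) (Q.map φ) := by
  rw [concat, concat, ← Matrix.submatrix_map, Matrix.fromCols_map]

theorem map_minorSum {S : Type*} [CommRing S] (φ : R →+* S) {m n k : ℕ} (h : k + k = m)
    (A B : Matrix (Fin m) (Fin n) R) (X : Matrix (Fin n) (Fin n) R) :
    φ (minorSum h A B X) = minorSum h (A.map φ) (B.map φ) (X.map φ) := by
  simp only [minorSum, map_sum, map_mul, RingHom.map_det, RingHom.mapMatrix_apply, concat_map]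
  rfl

theorem concat_castAdd {α : Type*} {r p q N : ℕ} (h : p + q = N) (P : Matrix (Fin r) (Fin p) α)
    (Q : Matrix (Fin r) (Fin q) α) (a : Fin r) (i : Fin p) :
    concat h P Q a (Fin.cast h (Fin.castAdd q i)) = P a i := by
  subst h
  simp [concat]

theorem concat_natAdd {α : Type*} {r p q N : ℕ} (h : p + q = N) (P : Matrix (Fin r) (Fin p) α)
    (Q : Matrix (Fin r) (Fin q) α) (a : Fin r) (j : Fin q) :
    concat h P Q a (Fin.cast h (Fin.natAdd p j)) = Q a j := by
  subst h
  simp only [concat, Matrix.submatrix_apply, Fin.cast_eq_self,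
    finSumFinEquiv_symm_apply_natAdd, Matrix.fromCols_apply_inr, id]

theorem det_concat {p q : ℕ} (P : Matrix (Fin (p + q)) (Fin p) R)
    (Q : Matrix (Fin (p + q)) (Fin q) R) :
    (concat rfl P Q).det = (Matrix.fromCols (P.submatrix finSumFinEquiv id)
      (Q.submatrix finSumFinEquiv id)).det := by
  rw [← Matrix.det_submatrix_equiv_self finSumFinEquiv]
  congr 1
  ext a (b | b)
  · exact concat_castAdd rfl P Q _ b
  · exact concat_natAdd rfl P Q _ b

/-- Grouping the sum over all `u`, `v` by their images yields `k! ^ 2` times the sum over subsets,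
since signs from reordering occur in both determinants; one factor `k!` then cancels. -/
theorem factorial_mul_minorSum [IsDomain R] [CharZero R] {n k : ℕ}
    (A B : Matrix (Fin (k + k)) (Fin n) R) (X : Matrix (Fin n) (Fin n) R) :
    (k.factorial : R) * minorSum rfl A B X =
      matchingSum ((A * X * Bᵀ).submatrix finSumFinEquiv finSumFinEquiv) := by
  set A' := A.submatrix (finSumFinEquiv (m := k) (n := k)) id with hA'
  set B' := B.submatrix (finSumFinEquiv (m := k) (n := k)) id with hB'
  have h1 : (A * X * Bᵀ).submatrix finSumFinEquiv finSumFinEquiv = A' * X * B'ᵀ := by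
    ext; simp [hA', hB', Matrix.mul_apply]
  have hk : (k.factorial : R) ≠ 0 := by exact_mod_cast k.factorial_ne_zero
  apply mul_left_cancel₀ hk
  have h2 := sum_det_mul_det_fromCols A' X B'
  rw [Fintype.card_fin] at h2
  rw [h1, ← h2, sum_fun_eq_factorial_mul_sum_kSubset, minorSum]
  · congr 1
    rw [Finset.mul_sum]
    refine Finset.sum_congr rfl fun I _ => ?_
    rw [sum_fun_eq_factorial_mul_sum_kSubset]
    · simp only [det_concat]
      rfl
    · intro v hv
      obtain ⟨a, b, hab, hne⟩ := Function.not_injective_iff.mp hv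
      rw [Matrix.det_zero_of_column_eq hne (fun i => by simp [hab]), zero_mul]
    · intro v τ
      rw [det_fromCols_submatrix_comp_right]
      have : X.submatrix (I.1.orderEmbOfFin I.2) (v ∘ τ) =
        (X.submatrix (I.1.orderEmbOfFin I.2) v).submatrix id τ := rfl
      rw [this, Matrix.det_permute', mul_mul_mul_comm, mul_assoc, sign_mul_sign_mul]
  · intro u hu
    obtain ⟨a, b, hab, hne⟩ := Function.not_injective_iff.mp hu
    refine Finset.sum_eq_zero fun v _ => ?_
    rw [Matrix.det_zero_of_row_eq hne (by ext; simp [hab]), zero_mul]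
  · intro u τ
    refine Finset.sum_congr rfl fun v _ => ?_
    rw [det_fromCols_submatrix_comp_left]
    have : X.submatrix (u ∘ τ) v = (X.submatrix u v).submatrix τ id := rfl
    rw [this, Matrix.det_permute, mul_mul_mul_comm, mul_assoc, sign_mul_sign_mul]

theorem allOnes_eq_vecMulVec (n : ℕ) : allOnes R n = Matrix.vecMulVec 1 1 := by
  ext; simp [allOnes, Matrix.vecMulVec_apply]

theorem mul_allOnes_sub_transpose_mul {m n : ℕ} (A B : Matrix (Fin m) (Fin n) R)
    (X : Matrix (Fin n) (Fin n) R) :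
    B * (allOnes R n - Xᵀ) * Aᵀ = Matrix.vecMulVec (B *ᵥ 1) (A *ᵥ 1) - (A * X * Bᵀ)ᵀ := by
  rw [allOnes_eq_vecMulVec, Matrix.mul_sub, Matrix.sub_mul, Matrix.mul_vecMulVec,
    Matrix.vecMulVec_mul, Matrix.vecMul_transpose]
  simp [Matrix.transpose_mul, Matrix.mul_assoc]

theorem det_eq_minorSum_mul_minorSum_of_isDomain [IsDomain R] [CharZero R] {n k : ℕ}
    (A B : Matrix (Fin (k + k)) (Fin n) R) (X : Matrix (Fin n) (Fin n) R) :
    (A * X * Bᵀ + B * (allOnes R n - Xᵀ) * Aᵀ).det =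
      minorSum rfl A B X * minorSum rfl B A (allOnes R n - Xᵀ) := by
  have hk : (k.factorial : R) ≠ 0 := by exact_mod_cast k.factorial_ne_zero
  apply mul_left_cancel₀ (pow_ne_zero 2 hk)
  have h := matchingSum_mul_matchingSum ((A * X * Bᵀ).submatrix finSumFinEquiv finSumFinEquiv)
    ((A *ᵥ 1) ∘ finSumFinEquiv) ((B *ᵥ 1) ∘ finSumFinEquiv)
  have h1 : Matrix.vecMulVec ((B *ᵥ 1) ∘ finSumFinEquiv) ((A *ᵥ 1) ∘ finSumFinEquiv) -
      ((A * X * Bᵀ).submatrix finSumFinEquiv finSumFinEquiv)ᵀ =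
      (B * (allOnes R n - Xᵀ) * Aᵀ).submatrix finSumFinEquiv finSumFinEquiv := by
    rw [mul_allOnes_sub_transpose_mul]
    rfl
  rw [h1, ← factorial_mul_minorSum, ← factorial_mul_minorSum, Fintype.card_fin] at h
  rw [← Matrix.det_submatrix_equiv_self (finSumFinEquiv (m := k) (n := k))]
  rw [show (A * X * Bᵀ + B * (allOnes R n - Xᵀ) * Aᵀ).submatrix finSumFinEquiv finSumFinEquiv =
    (A * X * Bᵀ).submatrix finSumFinEquiv finSumFinEquiv -
      ((A * X * Bᵀ).submatrix finSumFinEquiv finSumFinEquiv)ᵀ +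
      Matrix.vecMulVec ((B *ᵥ 1) ∘ finSumFinEquiv) ((A *ᵥ 1) ∘ finSumFinEquiv) by
        rw [add_comm_sub, ← add_sub_assoc, add_sub_assoc, h1]; rfl, ← h]
  ring

theorem det_eq_minorSum_mul_minorSum {m n k : ℕ} (h : k + k = m)
    (A B : Matrix (Fin m) (Fin n) R) (X : Matrix (Fin n) (Fin n) R) :
    (A * X * Bᵀ + B * (allOnes R n - Xᵀ) * Aᵀ).det =
      minorSum h A B X * minorSum h B A (allOnes R n - Xᵀ) := by
  subst h
  -- Matrices of independent indeterminates over `ℤ` live in a domain of characteristic zero and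
  -- specialise to any `A`, `B`, `X` over `R`.
  let U := MvPolynomial ((Fin (k + k) × Fin n) ⊕ (Fin (k + k) × Fin n) ⊕ (Fin n × Fin n)) ℤ
  let A₀ : Matrix (Fin (k + k)) (Fin n) U := Matrix.of fun i j => MvPolynomial.X (Sum.inl (i, j))
  let B₀ : Matrix (Fin (k + k)) (Fin n) U :=
    Matrix.of fun i j => MvPolynomial.X (Sum.inr (Sum.inl (i, j)))
  let X₀ : Matrix (Fin n) (Fin n) U := Matrix.of fun i j => MvPolynomial.X (Sum.inr (Sum.inr (i, j)))
  let φ : U →+* R := MvPolynomial.eval₂Hom (Int.castRingHom R)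
    (Sum.elim (fun x => A x.1 x.2) (Sum.elim (fun x => B x.1 x.2) (fun x => X x.1 x.2)))
  have hA : A₀.map φ = A := by ext; exact MvPolynomial.eval₂_X _ _ _
  have hB : B₀.map φ = B := by ext; exact MvPolynomial.eval₂_X _ _ _
  have hX : X₀.map φ = X := by ext; exact MvPolynomial.eval₂_X _ _ _
  have hJ : (allOnes U n).map φ = allOnes R n := by ext; simp [allOnes]
  simpa only [map_mul, map_minorSum, RingHom.map_det, RingHom.mapMatrix_apply, Matrix.map_mul,
    Matrix.map_add φ (map_add φ), Matrix.map_sub φ (map_sub φ), Matrix.transpose_map, hA, hB, hX,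
    hJ] using congr_arg φ (det_eq_minorSum_mul_minorSum_of_isDomain A₀ B₀ X₀)

end MinorSummation


/-! ### The odd case: bordering by one row and one column. -/

section Bordered

variable {R : Type*} [CommRing R]

/-- The block matrix with first row `(c 0)`, whose other rows are those of `A` preceded by `d`. -/
def bordered {m n : ℕ} (c d : R) (A : Matrix (Fin m) (Fin n) R) :
    Matrix (Fin (m + 1)) (Fin (n + 1)) R :=
  Matrix.of (Fin.cons (Fin.cons c 0) fun i => Fin.cons d (A i))

section apply

variable {m n : ℕ} (c d : R) (A : Matrix (Fin m) (Fin n) R)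

@[simp]
theorem bordered_zero_zero : bordered c d A 0 0 = c := rfl

@[simp]
theorem bordered_zero_succ (j : Fin n) : bordered c d A 0 j.succ = 0 := rfl

@[simp]
theorem bordered_succ_zero (i : Fin m) : bordered c d A i.succ 0 = d := rfl

@[simp]
theorem bordered_succ_succ (i : Fin m) (j : Fin n) : bordered c d A i.succ j.succ = A i j := rfl

end apply

theorem bordered_zero_of_ne_zero {m n : ℕ} (c d : R) (A : Matrix (Fin m) (Fin n) R)
    {j : Fin (n + 1)} (hj : j ≠ 0) : bordered c d A 0 j = 0 := by
  obtain ⟨j, rfl⟩ := Fin.exists_succ_eq.mpr hj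
  rfl

/-- The bordered shape survives `X ↦ 𝒥 - Xᵗ`: transposing moves the column of ones into the first
row, where the complement makes it zero. Only the corner changes. -/
theorem allOnes_sub_transpose_bordered {n : ℕ} (X : Matrix (Fin n) (Fin n) R) :
    allOnes R (n + 1) - (bordered 0 1 X)ᵀ = bordered 1 1 (allOnes R n - Xᵀ) := by
  ext i j
  refine Fin.cases ?_ (fun i => ?_) i <;> refine Fin.cases ?_ (fun j => ?_) j <;>
    simp [allOnes]

/-- The first row of the bordered sum is `(1, 0, …, 0)`, and deleting the first row and column
leaves the original sum. -/
theorem det_bordered_mul {m n : ℕ} (A B : Matrix (Fin m) (Fin n) R)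
    (X Y : Matrix (Fin n) (Fin n) R) :
    (bordered 1 0 A * bordered 0 1 X * (bordered 1 0 B)ᵀ +
      bordered 1 0 B * bordered 1 1 Y * (bordered 1 0 A)ᵀ).det =
      (A * X * Bᵀ + B * Y * Aᵀ).det := by
  set M := bordered 1 0 A * bordered 0 1 X * (bordered 1 0 B)ᵀ +
      bordered 1 0 B * bordered 1 1 Y * (bordered 1 0 A)ᵀ with hM
  have h1 : M 0 0 = 1 := by simp [hM, Matrix.mul_apply, Fin.sum_univ_succ]
  have h2 : ∀ j : Fin m, M 0 j.succ = 0 := fun j => by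
    simp [hM, Matrix.mul_apply, Fin.sum_univ_succ]
  have h3 : M.submatrix Fin.succ Fin.succ = A * X * Bᵀ + B * Y * Aᵀ := by
    ext i j
    simp [hM, Matrix.mul_apply, Fin.sum_univ_succ]
  rw [Matrix.det_succ_row_zero, Fin.sum_univ_succ]
  simp [h1, h2, ← h3]

/-- The image of a subset under `i ↦ i + 1`. -/
def KSubset.succ {n k : ℕ} (I : KSubset n k) : KSubset (n + 1) k :=
  ⟨I.1.map (Fin.succEmb n), by rw [Finset.card_map, I.2]⟩

/-- The image of a subset under `i ↦ i + 1`, together with `0`. -/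
def KSubset.consZero {n k : ℕ} (I : KSubset n k) : KSubset (n + 1) (k + 1) :=
  ⟨insert 0 (I.1.map (Fin.succEmb n)), by
    rw [Finset.card_insert_of_notMem (by simp), Finset.card_map, I.2]⟩

theorem KSubset.orderEmbOfFin_succ {n k : ℕ} (I : KSubset n k) (i : Fin k) :
    I.succ.1.orderEmbOfFin I.succ.2 i = (I.1.orderEmbOfFin I.2 i).succ := by
  refine (congr_fun (Finset.orderEmbOfFin_unique I.succ.2
    (f := fun i => (I.1.orderEmbOfFin I.2 i).succ) (fun x => ?_) ?_) i).symm
  · exact Finset.mem_map.mpr ⟨_, Finset.orderEmbOfFin_mem _ _ _, rfl⟩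
  · exact fun a b hab => Fin.succ_lt_succ_iff.mpr ((I.1.orderEmbOfFin I.2).strictMono hab)

theorem KSubset.orderEmbOfFin_consZero {n k : ℕ} (I : KSubset n k) :
    I.consZero.1.orderEmbOfFin I.consZero.2 =
      (Fin.cons 0 fun i => (I.1.orderEmbOfFin I.2 i).succ : Fin (k + 1) → Fin (n + 1)) := by
  refine (Finset.orderEmbOfFin_unique I.consZero.2 (fun x => ?_) ?_).symm
  · refine Fin.cases ?_ (fun x => ?_) x
    · exact Finset.mem_insert_self _ _
    · exact Finset.mem_insert_of_mem (Finset.mem_map.mpr ⟨_, Finset.orderEmbOfFin_mem _ _ _, rfl⟩)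
  · intro a b
    refine Fin.cases ?_ (fun a => ?_) a <;> refine Fin.cases ?_ (fun b => ?_) b
    · simp
    · simp
    · simp
    · intro hab
      exact Fin.succ_lt_succ_iff.mpr
        ((I.1.orderEmbOfFin I.2).strictMono (Fin.succ_lt_succ_iff.mp hab))

theorem KSubset.succ_injective {n k : ℕ} :
    Function.Injective (KSubset.succ : KSubset n k → KSubset (n + 1) k) := fun _ _ h =>
  Subtype.ext (Finset.map_injective _ (Subtype.ext_iff.mp h))

theorem KSubset.consZero_injective {n k : ℕ} :
    Function.Injective (KSubset.consZero : KSubset n k → KSubset (n + 1) (k + 1)) := by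
  intro I J h
  have h' := congr_arg (fun s => Finset.erase s 0) (Subtype.ext_iff.mp h)
  simp only [KSubset.consZero] at h'
  rw [Finset.erase_insert (by simp), Finset.erase_insert (by simp)] at h'
  exact Subtype.ext (Finset.map_injective _ h')

theorem exists_map_succEmb_eq {n : ℕ} {s : Finset (Fin (n + 1))} (hs : 0 ∉ s) :
    ∃ t : Finset (Fin n), t.map (Fin.succEmb n) = s := by
  refine ⟨univ.filter fun i => i.succ ∈ s, ?_⟩
  ext a
  refine Fin.cases ?_ (fun a => ?_) a
  · simp [hs]
  · simp

theorem KSubset.exists_succ_eq {n k : ℕ} {I : KSubset (n + 1) k} (h : 0 ∉ I.1) :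
    ∃ I' : KSubset n k, I'.succ = I := by
  obtain ⟨t, ht⟩ := exists_map_succEmb_eq h
  exact ⟨⟨t, by rw [← I.2, ← ht, Finset.card_map]⟩, Subtype.ext ht⟩

theorem KSubset.exists_consZero_eq {n k : ℕ} {I : KSubset (n + 1) (k + 1)} (h : 0 ∈ I.1) :
    ∃ I' : KSubset n k, I'.consZero = I := by
  obtain ⟨t, ht⟩ := exists_map_succEmb_eq (Finset.notMem_erase 0 I.1)
  refine ⟨⟨t, ?_⟩, Subtype.ext ?_⟩
  · rw [← Finset.card_map (Fin.succEmb n), ht, Finset.card_erase_of_mem h, I.2]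
    rfl
  · rw [KSubset.consZero]
    simp only [ht, Finset.insert_erase h]

/-- The sum of `det (1 X_{I,J}) * det (A^I B^J)` over all `I, J ⊆ [n]` with `|I| = p`,
`|J| = q`. -/
def onesMinorSum {m n p q : ℕ} (h₁ : 1 + q = p) (h : p + q = m) (A B : Matrix (Fin m) (Fin n) R)
    (X : Matrix (Fin n) (Fin n) R) : R :=
  ∑ I : KSubset n p, ∑ J : KSubset n q,
    (concat h₁ (onesCol R p) (minorSub X I J)).det * (concat h (colSub A I) (colSub B J)).det

theorem g_eq_onesMinorSum {m n : ℕ} (hm : Odd m) (A B : Matrix (Fin m) (Fin n) R)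
    (X : Matrix (Fin n) (Fin n) R) :
    g hm A B X = onesMinorSum (one_add_lower hm) (upper_add_lower hm) A B X := rfl

theorem minorSub_bordered {n q : ℕ} (c : R) (X : Matrix (Fin n) (Fin n) R) (h₁ : 1 + q = q + 1)
    (I : KSubset n (q + 1)) (J : KSubset n q) :
    minorSub (bordered c 1 X) I.succ J.consZero =
      concat h₁ (onesCol R (q + 1)) (minorSub X I J) := by
  ext i j
  refine Fin.cases ?_ (fun j => ?_) j
  · rw [minorSub, Matrix.submatrix_apply, KSubset.orderEmbOfFin_succ,
      KSubset.orderEmbOfFin_consZero, Fin.cons_zero, bordered_succ_zero]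
    exact (concat_castAdd h₁ (onesCol R (q + 1)) (minorSub X I J) i 0).symm
  · rw [minorSub, Matrix.submatrix_apply, KSubset.orderEmbOfFin_succ,
      KSubset.orderEmbOfFin_consZero, Fin.cons_succ, bordered_succ_succ,
      show j.succ = Fin.cast h₁ (Fin.natAdd 1 j) from Fin.ext (by simp), concat_natAdd]
    rfl

theorem exists_eq_cast_castAdd_or_natAdd {p q N : ℕ} (h : p + q = N) (j : Fin N) :
    (∃ i : Fin p, j = Fin.cast h (Fin.castAdd q i)) ∨
      ∃ i : Fin q, j = Fin.cast h (Fin.natAdd p i) := by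
  subst h
  refine Fin.addCases (fun i => Or.inl ⟨i, rfl⟩) (fun i => Or.inr ⟨i, rfl⟩) j

theorem det_concat_bordered {m n q : ℕ} (h : q + 1 + (q + 1) = m + 1) (h₂ : q + 1 + q = m)
    (A B : Matrix (Fin m) (Fin n) R) (I : KSubset n (q + 1)) (J : KSubset n q) :
    (concat h (colSub (bordered 1 0 A) I.succ) (colSub (bordered 1 0 B) J.consZero)).det =
      (-1) ^ (q + 1) * (concat h₂ (colSub A I) (colSub B J)).det := by
  have hA : ∀ r i, colSub (bordered 1 0 A) I.succ r i =
      bordered 1 0 A r (I.1.orderEmbOfFin I.2 i).succ := fun r i => by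
    rw [← KSubset.orderEmbOfFin_succ]; rfl
  have hB : ∀ r i, colSub (bordered 1 0 B) J.consZero r i = bordered 1 0 B r
      ((Fin.cons 0 fun i => (J.1.orderEmbOfFin J.2 i).succ : Fin (q + 1) → Fin (n + 1)) i) :=
    fun r i => by rw [← KSubset.orderEmbOfFin_consZero]; rfl
  -- The only nonzero entry of the first row is in the first column taken from `B`, preceded by the
  -- `q + 1` columns from `A`; this gives the sign.
  rw [Matrix.det_succ_row_zero, Finset.sum_eq_single (Fin.cast h (Fin.natAdd (q + 1) 0))]
  · rw [concat_natAdd, hB, Fin.cons_zero, bordered_zero_zero, mul_one]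
    congr 2
    ext r j
    rw [Matrix.submatrix_apply]
    obtain ⟨i, rfl⟩ | ⟨i, rfl⟩ := exists_eq_cast_castAdd_or_natAdd h₂ j
    · rw [Fin.succAbove_of_castSucc_lt _ _ (by simp [Fin.lt_def, Nat.le_of_lt_succ i.2]),
        show (Fin.cast h₂ (Fin.castAdd q i)).castSucc = Fin.cast h (Fin.castAdd (q + 1) i) from
          Fin.ext (by simp), concat_castAdd, concat_castAdd, hA]
      rfl
    · rw [Fin.succAbove_of_le_castSucc _ _ (by simp [Fin.le_def]),
        show (Fin.cast h₂ (Fin.natAdd (q + 1) i)).succ = Fin.cast h (Fin.natAdd (q + 1) i.succ) from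
          Fin.ext (by simp; omega), concat_natAdd, concat_natAdd, hB]
      rfl
  · intro j _ hj
    obtain ⟨i, rfl⟩ | ⟨i, rfl⟩ := exists_eq_cast_castAdd_or_natAdd h j
    · rw [concat_castAdd, hA]; simp
    · obtain ⟨i, rfl⟩ := Fin.exists_succ_eq.mpr (show i ≠ 0 from fun hi => hj (by rw [hi]))
      rw [concat_natAdd, hB]; simp
  · simp

theorem exists_orderEmbOfFin_eq {n k : ℕ} (I : KSubset n k) {a : Fin n} (ha : a ∈ I.1) :
    ∃ i, I.1.orderEmbOfFin I.2 i = a := by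
  have : a ∈ Set.range (I.1.orderEmbOfFin I.2) := by rwa [Finset.range_orderEmbOfFin]
  exact this

theorem orderEmbOfFin_ne {n k : ℕ} (I : KSubset n k) {a : Fin n} (ha : a ∉ I.1) (i : Fin k) :
    I.1.orderEmbOfFin I.2 i ≠ a := fun h => ha (h ▸ Finset.orderEmbOfFin_mem _ _ _)

/-- Only pairs with `0 ∉ I` and `0 ∈ J` survive. If `0` is in both, the concatenation has two equal
columns; if only in `I`, the minor of the bordered `X` has a zero row; if in neither, the
concatenation has a zero row. Hence the corner `c` plays no role. -/
theorem minorSum_bordered {m n p q : ℕ} (h₁ : 1 + q = p) (h₂ : p + q = m) (h : p + p = m + 1)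
    (c : R) (A B : Matrix (Fin m) (Fin n) R) (X : Matrix (Fin n) (Fin n) R) :
    minorSum h (bordered 1 0 A) (bordered 1 0 B) (bordered c 1 X) =
      (-1) ^ p * onesMinorSum h₁ h₂ A B X := by
  obtain rfl : p = q + 1 := by omega
  rw [minorSum, onesMinorSum, ← Fintype.sum_prod_type', ← Fintype.sum_prod_type', Finset.mul_sum]
  symm
  refine Finset.sum_of_injOn (fun x : KSubset n (q + 1) × KSubset n q => (x.1.succ, x.2.consZero))
    ?_ (by simp) ?_ ?_
  · rintro ⟨I, J⟩ - ⟨I', J'⟩ - hIJ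
    exact Prod.ext (KSubset.succ_injective (congr_arg Prod.fst hIJ))
      (KSubset.consZero_injective (congr_arg Prod.snd hIJ))
  · rintro ⟨I, J⟩ - hIJ
    by_cases hI : 0 ∈ I.1
    · obtain ⟨i, hi⟩ := exists_orderEmbOfFin_eq I hI
      by_cases hJ : 0 ∈ J.1
      · obtain ⟨j, hj⟩ := exists_orderEmbOfFin_eq J hJ
        rw [Matrix.det_zero_of_column_eq (M := concat h _ _)
          (i := Fin.cast h (Fin.castAdd (q + 1) i)) (j := Fin.cast h (Fin.natAdd (q + 1) j)),
          mul_zero]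
        · simp [Fin.ext_iff]; omega
        · intro r
          rw [concat_castAdd, concat_natAdd, colSub, colSub, Matrix.submatrix_apply,
            Matrix.submatrix_apply, hi, hj]
          exact Fin.cases rfl (fun _ => rfl) r
      · rw [Matrix.det_eq_zero_of_row_eq_zero i, zero_mul]
        intro j
        rw [minorSub, Matrix.submatrix_apply, hi]
        exact bordered_zero_of_ne_zero _ _ _ (orderEmbOfFin_ne J hJ j)
    · have hJ : 0 ∉ J.1 := fun hJ => by
        obtain ⟨I', rfl⟩ := KSubset.exists_succ_eq hI
        obtain ⟨J', rfl⟩ := KSubset.exists_consZero_eq hJ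
        exact hIJ ⟨(I', J'), by simp, rfl⟩
      rw [Matrix.det_eq_zero_of_row_eq_zero (A := concat h _ _) 0, mul_zero]
      intro j
      obtain ⟨i, rfl⟩ | ⟨i, rfl⟩ := exists_eq_cast_castAdd_or_natAdd h j
      · rw [concat_castAdd]
        exact bordered_zero_of_ne_zero 1 0 A (orderEmbOfFin_ne I hI i)
      · rw [concat_natAdd]
        exact bordered_zero_of_ne_zero 1 0 B (orderEmbOfFin_ne J hJ i)
  · rintro ⟨I, J⟩ -
    rw [minorSub_bordered c X h₁, det_concat_bordered h h₂]
    ring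

theorem det_eq_onesMinorSum_mul_onesMinorSum {m n p q : ℕ} (h₁ : 1 + q = p) (h₂ : p + q = m)
    (A B : Matrix (Fin m) (Fin n) R) (X : Matrix (Fin n) (Fin n) R) :
    (A * X * Bᵀ + B * (allOnes R n - Xᵀ) * Aᵀ).det =
      onesMinorSum h₁ h₂ A B X * onesMinorSum h₁ h₂ B A (allOnes R n - Xᵀ) := by
  have h : p + p = m + 1 := by omega
  have key := det_eq_minorSum_mul_minorSum h (bordered 1 0 A) (bordered 1 0 B) (bordered 0 1 X)
  -- Both factors acquire the same sign `(-1) ^ p`, which cancels in the product.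
  rw [allOnes_sub_transpose_bordered, det_bordered_mul, minorSum_bordered h₁ h₂,
    minorSum_bordered h₁ h₂, mul_mul_mul_comm, ← mul_pow] at key
  simpa using key

/-- Each of the `q` columns of the minor is negated and then has the column of ones added to it. -/
theorem det_concat_onesCol_allOnes_sub {n p q : ℕ} (h₁ : 1 + q = p) (X : Matrix (Fin n) (Fin n) R)
    (I : KSubset n p) (J : KSubset n q) :
    (concat h₁ (onesCol R p) (minorSub (allOnes R n - X) I J)).det =
      (-1) ^ q * (concat h₁ (onesCol R p) (minorSub X I J)).det := by
  subst h₁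
  rw [det_concat, det_concat]
  have h : Matrix.fromCols ((onesCol R (1 + q)).submatrix finSumFinEquiv id)
      ((minorSub (allOnes R n - X) I J).submatrix finSumFinEquiv id) =
      Matrix.fromCols ((onesCol R (1 + q)).submatrix finSumFinEquiv id)
        ((minorSub X I J).submatrix finSumFinEquiv id) *
        Matrix.fromBlocks 1 (Matrix.of fun _ _ => 1) 0 (-1) := by
    rw [Matrix.fromCols_mul_fromBlocks]
    ext i (j | j)
    · simp
    · simp [Matrix.mul_apply, onesCol, minorSub, allOnes, sub_eq_add_neg]
  rw [h, Matrix.det_mul, Matrix.det_fromBlocks_zero₂₁, Matrix.det_neg]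
  simp [mul_comm]

theorem onesMinorSum_allOnes_sub {m n p q : ℕ} (h₁ : 1 + q = p) (h₂ : p + q = m)
    (A B : Matrix (Fin m) (Fin n) R) (X : Matrix (Fin n) (Fin n) R) :
    onesMinorSum h₁ h₂ A B (allOnes R n - X) = (-1) ^ q * onesMinorSum h₁ h₂ A B X := by
  simp only [onesMinorSum, det_concat_onesCol_allOnes_sub, Finset.mul_sum, mul_assoc]

end Bordered
end MinorSum

theorem theorem1p3 {R : Type*} [CommRing R] (m n : ℕ)
    (A B : Matrix (Fin m) (Fin n) R) (X : Matrix (Fin n) (Fin n) R) :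
    (∀ hm : Even m,
      (A * X * Bᵀ + B * (MinorSum.allOnes R n - Xᵀ) * Aᵀ).det =
        MinorSum.f hm A B X * MinorSum.f hm B A (MinorSum.allOnes R n - Xᵀ)) ∧
    (∀ hm : Odd m,
      (A * X * Bᵀ + B * (MinorSum.allOnes R n - Xᵀ) * Aᵀ).det =
        MinorSum.g hm A B X * MinorSum.g hm B A (MinorSum.allOnes R n - Xᵀ) ∧
      MinorSum.g hm A B X * MinorSum.g hm B A (MinorSum.allOnes R n - Xᵀ) =
        (-1) ^ ((m - 1) / 2) * MinorSum.g hm A B X * MinorSum.g hm B A Xᵀ) := by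
  refine ⟨fun hm => ?_, fun hm => ⟨?_, ?_⟩⟩
  · exact MinorSum.det_eq_minorSum_mul_minorSum (MinorSum.half_add_half hm) A B X
  · exact MinorSum.det_eq_onesMinorSum_mul_onesMinorSum (MinorSum.one_add_lower hm)
      (MinorSum.upper_add_lower hm) A B X
  · simp only [MinorSum.g_eq_onesMinorSum, MinorSum.onesMinorSum_allOnes_sub]
    ring
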